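/- Let $p$ be an odd prime, and let $G$ be a simple undirected graph with vertex set $\{1,\dots,n\}$ and $m\ge 1$ edges. Let $\mathcal A_G$ be the space of alternating $n\times n$ matrices over $\mathbb F_p$ spanned by the matrices $E_{ij}-E_{ji}$, where $\{i,j\}$, $i<j$, runs over the edges of $G$; it has dimension $m$. Let $(A_1,\dots,A_m)$ be any ordered basis of $\mathcal A_G$, put $\phi(v,u)=(v^tA_1u,\dots,v^tA_mu)^t$, and let $P_G$ be the set $\mathbb F_p^n\oplus\mathbb F_p^m$ with the product $$(v_1,u_1)\circ(v_2,u_2)=\bigl(v_1+v_2,\;u_1+u_2+\tfrac12\phi(v_1,v_2)\bigr).$$ Then $P_G$ is a non-abelian group of nilpotency class $2$ and exponent $p$ with $|P_G/[P_G,P_G]|=p^n$ and $|[P_G,P_G]|=p^m$. A group $H$ \emph{admits a central decomposition} if it has subgroups $J,K$, both non-trivial and proper, such that every element of $J$ commutes with every element of $K$ and $H=JK$. A subgroup $S$ of $P=P_G$ is \emph{regular} if $[S,S]=S\cap[P,P]$. Let $\kappa(P)$ be the least integer $0\le s\le n$ such that some regular subgroup $S\le P$ with $|S/[S,S]|=p^{n-s}$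 admits a central decomposition or has order $p$ (groups of order $p$ being counted as degenerately decomposable). Let $\lambda(P)$ be the least $s\ge 0$ such that, for some central subgroup $N\le P$ of order $p^s$, the quotient $P/N$ admits a central decomposition. Let the vertex connectivity $\kappa(G)$ be the least number of vertices whose removal leaves a disconnected graph or a single vertex (so the complete graph has $\kappa=n-1$), and let the edge connectivity $\lambda(G)$ be the least number of edges whose removal leaves a disconnected graph. Then all four minima exist, and $$\kappa(G)=\kappa(P_G),\qquad \lambda(G)=\lambda(P_G).$$ Moreover, the first equality also holds without the two degenerate conventions: the least number of vertices whose removal leaves a disconnected graph exists if and only if the least $s$ such that some regular subgroup $S$ with $|S/[S,S]|=p^{n-s}$ admits a central decomposition exists, and then the two numbers are equal. -/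

import Mathlib

noncomputable section

namespace BLT

/-! ### From graphs to groups -/

/-- The elementary alternating matrix `A_{i,j}`: entry `1` at `(i,j)`, entry `-1` at `(j,i)`
(for `i ≠ j`), and `0` elsewhere. -/
def elemAlt (F : Type*) [Field F] {n : ℕ} (i j : Fin n) : Matrix (Fin n) (Fin n) F :=
  Matrix.single i j 1 - Matrix.single j i 1

/-- The alternating matrix space `𝒜_G`, spanned by the `A_{i,j}` over the edges `{i,j}`, `i < j`. -/
def graphSpace (F : Type*) [Field F] {n : ℕ} (G : SimpleGraph (Fin n)) :
    Submodule F (Matrix (Fin n) (Fin n) F) :=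
  Submodule.span F {M | ∃ i j : Fin n, i < j ∧ G.Adj i j ∧ M = elemAlt F i j}

/-- The bilinear map `(v, u) ↦ (vᵗ A₁ u, …, vᵗ A_m u)` of a tuple of matrices. -/
def tupleBilin {F : Type*} [Field F] {n m : ℕ} (A : Fin m → Matrix (Fin n) (Fin n) F) :
    (Fin n → F) →ₗ[F] (Fin n → F) →ₗ[F] (Fin m → F) :=
  LinearMap.mk₂ F (fun v u k => v ⬝ᵥ (A k).mulVec u)
    (fun v v' u => by ext k; simp [add_dotProduct])
    (fun c v u => by ext k; simp [smul_dotProduct])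
    (fun v u u' => by ext k; simp [Matrix.mulVec_add, dotProduct_add])
    (fun c v u => by ext k; simp [Matrix.mulVec_smul, dotProduct_smul])

/-- The underlying set `F^n ⊕ F^m` of the group `P_φ`. -/
@[ext]
structure BaerGroup {F : Type*} [Field F] {n m : ℕ}
    (φ : (Fin n → F) →ₗ[F] (Fin n → F) →ₗ[F] (Fin m → F)) where
  /-- component in `F^n` -/
  fst : Fin n → F
  /-- component in `F^m` -/
  snd : Fin m → F

namespace BaerGroup

variable {F : Type*} [Field F] {n m : ℕ}
  {φ : (Fin n → F) →ₗ[F] (Fin n → F) →ₗ[F] (Fin m → F)}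

/-- `(v₁, u₁) ∘ (v₂, u₂) = (v₁ + v₂, u₁ + u₂ + ½ φ(v₁, v₂))`. -/
instance : Mul (BaerGroup φ) :=
  ⟨fun x y => ⟨x.fst + y.fst, x.snd + y.snd + (2 : F)⁻¹ • φ x.fst y.fst⟩⟩

instance : One (BaerGroup φ) := ⟨⟨0, 0⟩⟩

/-- For alternating `φ` the last summand vanishes. -/
instance : Inv (BaerGroup φ) :=
  ⟨fun x => ⟨-x.fst, -x.snd + (2 : F)⁻¹ • φ x.fst x.fst⟩⟩

theorem fst_mul (x y : BaerGroup φ) : (x * y).fst = x.fst + y.fst := rfl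

theorem snd_mul (x y : BaerGroup φ) :
    (x * y).snd = x.snd + y.snd + (2 : F)⁻¹ • φ x.fst y.fst := rfl

theorem fst_one : (1 : BaerGroup φ).fst = 0 := rfl

theorem snd_one : (1 : BaerGroup φ).snd = 0 := rfl

theorem fst_inv (x : BaerGroup φ) : (x⁻¹).fst = -x.fst := rfl

theorem snd_inv (x : BaerGroup φ) :
    (x⁻¹).snd = -x.snd + (2 : F)⁻¹ • φ x.fst x.fst := rfl

instance : Group (BaerGroup φ) :=
  Group.ofLeftAxioms
    (fun x y z => by
      ext1
      · simp only [fst_mul, add_assoc]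
      · simp only [snd_mul, fst_mul, map_add, LinearMap.add_apply, smul_add]
        abel)
    (fun x => by
      ext1
      · simp [fst_mul, fst_one]
      · simp [snd_mul, fst_one, snd_one])
    (fun x => by
      ext1
      · simp [fst_mul, fst_one, fst_inv]
      · simp [snd_mul, snd_one, fst_inv, snd_inv])

end BaerGroup

/-- The group `P_G` over `𝔽_p`, built from an ordered basis of `𝒜_G`. -/
abbrev graphGroup (p : ℕ) [Fact p.Prime] {n m : ℕ} (G : SimpleGraph (Fin n))
    (b : Module.Basis (Fin m) (ZMod p) (graphSpace (ZMod p) G)) : Type :=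
  BaerGroup (tupleBilin fun k => (b k : Matrix (Fin n) (Fin n) (ZMod p)))

/-! ### The group parameters -/

/-- `P` belongs to `𝔅_{p,2}(n, m)`: non-abelian, of class `2` and exponent `p`, with
`|P/[P,P]| = p^n` and `|[P,P]| = p^m`. -/
structure IsB (p n m : ℕ) (P : Type*) [Group P] : Prop where
  nonabelian : ∃ g h : P, g * h ≠ h * g
  exponent : ∀ g : P, g ^ p = 1
  class_two : commutator P ≤ Subgroup.center P
  card_quotient : Nat.card (P ⧸ commutator P) = p ^ n
  card_commutator : Nat.card (commutator P) = p ^ m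

/-- `H` is a central product of two non-trivial proper subgroups `J` and `K`. -/
def CentrallyDecomposable (H : Type*) [Group H] : Prop :=
  ∃ J K : Subgroup H, J ≠ ⊥ ∧ J ≠ ⊤ ∧ K ≠ ⊥ ∧ K ≠ ⊤ ∧
    (∀ j ∈ J, ∀ k ∈ K, j * k = k * j) ∧ ∀ h : H, ∃ j ∈ J, ∃ k ∈ K, h = j * k

/-- `S` is regular with respect to commutation: `[S,S] = S ∩ [P,P]`. -/
def IsRegular {P : Type*} [Group P] (S : Subgroup P) : Prop :=
  ⁅S, S⁆ = S ⊓ commutator P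

/-- The `s` for which some regular `S ≤ P` with `|S/[S,S]| = p^(n-s)` admits a central
decomposition, no convention being made for groups of order `p`. -/
def strictKappaSet (p n : ℕ) (P : Type*) [Group P] : Set ℕ :=
  {s | s ≤ n ∧ ∃ S : Subgroup P, IsRegular S ∧ Nat.card (S ⧸ commutator S) = p ^ (n - s) ∧
    CentrallyDecomposable S}

/-- The same set, with the groups of order `p` counted as (degenerately) decomposable; its least
element is `κ(P)`. -/
def kappaSet (p n : ℕ) (P : Type*) [Group P] : Set ℕ :=
  {s | s ≤ n ∧ ∃ S : Subgroup P, IsRegular S ∧ Nat.card (S ⧸ commutator S) = p ^ (n - s) ∧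
    (CentrallyDecomposable S ∨ Nat.card S = p)}

/-- The `s` for which some central subgroup `N` of order `p^s` has a centrally decomposable
quotient `P/N`; its least element is `λ(P)`. -/
def lambdaSet (p : ℕ) (P : Type*) [Group P] : Set ℕ :=
  {s | ∃ (N : Subgroup P) (_ : N.Normal), N ≤ Subgroup.center P ∧ Nat.card N = p ^ s ∧
    CentrallyDecomposable (P ⧸ N)}

/-! ### The graph parameters -/

/-- The sizes of the vertex sets whose removal leaves a disconnected graph (the graph without
vertices does not count as disconnected). -/
def vertexSeparatorSizes {n : ℕ} (G : SimpleGraph (Fin n)) : Set ℕ :=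
  {s | ∃ X : Finset (Fin n), X.card = s ∧ ¬ (G.induce {v | v ∉ X}).Preconnected}

/-- The sizes of the vertex sets whose removal leaves a disconnected graph or a single vertex; the
least element is the vertex connectivity `κ(G)`, which is `n - 1` for the complete graph. -/
def vertexCutSizes {n : ℕ} (G : SimpleGraph (Fin n)) : Set ℕ :=
  {s | ∃ X : Finset (Fin n), X.card = s ∧
    (¬ (G.induce {v | v ∉ X}).Preconnected ∨ n = X.card + 1)}

/-- The sizes of the edge sets whose removal leaves a disconnected graph; the least element is the
edge connectivity `λ(G)`. -/
def edgeCutSizes {n : ℕ} (G : SimpleGraph (Fin n)) : Set ℕ :=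
  {s | ∃ D : Finset (Sym2 (Fin n)), (D : Set (Sym2 (Fin n))) ⊆ G.edgeSet ∧ D.card = s ∧
    ¬ (G.deleteEdges (D : Set (Sym2 (Fin n)))).Preconnected}

end BLT

end

/-! The group is controlled by the form `φ`: the commutator of two elements is `(0, φ(v₁, v₂))`, so
they commute exactly when `φ` vanishes on their first components. The values of `φ` span `F_p^m`,
hence `[P, P]` is the second summand, and for regular `S` the quotient `S/[S,S]` is the projection
of `S` to `F_p^n`. A central decomposition of `S` therefore gives incomparable subspaces `U`, `W`
spanning that projection with `uᵗAw = 0` for all `A ∈ 𝒜_G`. For `P/N` with `N` inside the second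
summand, the same holds modulo `N`, with `U` and `W` proper and `U + W` the whole space.

Coordinate subspaces turn graph cuts into central decompositions. The converse must extract vertices
from arbitrary `U`, `W`. If some coordinate vanishes on neither of them, its vertex is split off
alone: relations `u_i g(w) = g(u) w_i` force `g` to be a multiple of that coordinate
(`exists_eq_smul_of_mul_eq_mul`). Otherwise every coordinate vanishes on `U` or on `W`, and this
sorts the vertices into two classes.

For `κ` the argument runs on coordinates forming a basis of the dual of `U + W`
(`exists_coordinates`, `exists_separation`), and the two sets of sizes even coincide. For `λ` it
yields a bipartition whose crossing matrices are detected by `U × W` (`exists_crossing_separating`).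
They embed in the dual of `N`, so `dim N` is at least the number of crossing edges
(`ncard_edgeSet_le_finrank`). -/

namespace BLT

/-! ### Matrices of a graph and proportional functionals -/

section LinearAlgebra

theorem elemAlt_mem_graphSpace {F : Type*} [Field F] {n : ℕ} {G : SimpleGraph (Fin n)}
    {i j : Fin n} (h : G.Adj i j) : elemAlt F i j ∈ graphSpace F G := by
  rcases lt_or_gt_of_ne h.ne with hij | hij
  · exact Submodule.subset_span ⟨i, j, hij, h, rfl⟩
  · have : elemAlt F i j = - elemAlt F j i := by simp [elemAlt]
    rw [this]
    exact neg_mem (Submodule.subset_span ⟨j, i, hij, h.symm, rfl⟩)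

theorem graphSpace_mono (F : Type*) [Field F] {n : ℕ} {G H : SimpleGraph (Fin n)} (h : H ≤ G) :
    graphSpace F H ≤ graphSpace F G :=
  Submodule.span_mono fun _ ⟨i, j, hij, hadj, e⟩ => ⟨i, j, hij, h hadj, e⟩

theorem dotProduct_elemAlt_mulVec {F : Type*} [Field F] {n : ℕ} (i j : Fin n)
    (u w : Fin n → F) : u ⬝ᵥ (elemAlt F i j).mulVec w = u i * w j - u j * w i := by
  simp [elemAlt, Matrix.sub_mulVec, dotProduct_sub, Matrix.single_mulVec]
  simp [dotProduct, Function.update_apply, mul_ite]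

theorem graphSpace_apply_swap {F : Type*} [Field F] {n : ℕ} {G : SimpleGraph (Fin n)}
    {A : Matrix (Fin n) (Fin n) F} (hA : A ∈ graphSpace F G) (i j : Fin n) : A j i = - A i j := by
  induction hA using Submodule.span_induction with
  | mem x hx =>
    obtain ⟨a, b, -, -, rfl⟩ := hx
    simp only [elemAlt, Matrix.sub_apply, Matrix.single_apply]
    simp [and_comm]
  | zero => simp
  | add x y _ _ hx hy => simp [hx, hy]; ring
  | smul c x _ hx => simp [hx]

theorem graphSpace_apply_eq_zero {F : Type*} [Field F] {n : ℕ} {G : SimpleGraph (Fin n)}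
    {A : Matrix (Fin n) (Fin n) F} (hA : A ∈ graphSpace F G) {i j : Fin n} (h : ¬ G.Adj i j) :
    A i j = 0 := by
  induction hA using Submodule.span_induction with
  | mem x hx =>
    obtain ⟨a, b, -, hab, rfl⟩ := hx
    have h1 : ¬ (a = i ∧ b = j) := by rintro ⟨rfl, rfl⟩; exact h hab
    have h2 : ¬ (b = i ∧ a = j) := by rintro ⟨rfl, rfl⟩; exact h hab.symm
    simp [elemAlt, h1, h2]
  | zero => simp
  | add x y _ _ hx hy => simp [hx, hy]
  | smul c x _ hx => simp [hx]

theorem dotProduct_mulVec_self_of_mem_graphSpace {F : Type*} [Field F] {n : ℕ}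
    {G : SimpleGraph (Fin n)} {A : Matrix (Fin n) (Fin n) F} (hA : A ∈ graphSpace F G)
    (v : Fin n → F) : v ⬝ᵥ A.mulVec v = 0 := by
  induction hA using Submodule.span_induction with
  | mem x hx =>
    obtain ⟨a, b, -, -, rfl⟩ := hx
    rw [dotProduct_elemAlt_mulVec]; ring
  | zero => simp
  | add x y _ _ hx hy => simp [Matrix.add_mulVec, dotProduct_add, hx, hy]
  | smul c x _ hx => simp [Matrix.smul_mulVec, dotProduct_smul, hx]

/-- The edges of `G`, written as increasing pairs. -/
abbrev IncreasingEdge {n : ℕ} (G : SimpleGraph (Fin n)) : Type :=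
  {e : Fin n × Fin n // e.1 < e.2 ∧ G.Adj e.1 e.2}

theorem card_increasingEdge {n : ℕ} (G : SimpleGraph (Fin n)) :
    Nat.card (IncreasingEdge G) = G.edgeSet.ncard := by
  rw [← Nat.card_coe_set_eq]
  refine Nat.card_eq_of_bijective
    (fun e => (⟨s(e.1.1, e.1.2), e.2.2⟩ : G.edgeSet)) ⟨?_, ?_⟩
  · rintro ⟨⟨i, j⟩, hij, h⟩ ⟨⟨k, l⟩, hkl, h'⟩ he
    simp only [Subtype.mk.injEq, Prod.mk.injEq] at he ⊢
    simp only at hij hkl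
    rcases Sym2.eq_iff.1 (congrArg Subtype.val he) with he | ⟨rfl, rfl⟩
    · exact he
    · exact absurd hij hkl.asymm
  · rintro ⟨e, he⟩
    induction e using Sym2.ind with
    | _ i j =>
      rcases lt_or_gt_of_ne (G.ne_of_adj he) with hij | hij
      · exact ⟨⟨(i, j), hij, he⟩, rfl⟩
      · exact ⟨⟨(j, i), hij, SimpleGraph.Adj.symm he⟩, Subtype.ext Sym2.eq_swap⟩

theorem finrank_graphSpace (F : Type*) [Field F] {n : ℕ} (G : SimpleGraph (Fin n)) :
    Module.finrank F (graphSpace F G) = G.edgeSet.ncard := by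
  classical
  have hli : LinearIndependent F (fun e : IncreasingEdge G => elemAlt F e.1.1 e.1.2) := by
    rw [Fintype.linearIndependent_iff]
    intro g hg e
    -- Among increasing pairs, only `e` itself contributes to this entry, so the entry is the
    -- coefficient of `e`.
    have h := congrFun (congrFun hg e.1.1) e.1.2
    obtain ⟨⟨k, l⟩, hkl, hadj⟩ := e
    rw [Matrix.sum_apply, Finset.sum_eq_single ⟨(k, l), hkl, hadj⟩] at h
    · simpa [elemAlt, Matrix.single_apply, hkl.ne'] using h
    · rintro ⟨⟨i, j⟩, hij, hadj⟩ - hne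
      simp only [ne_eq, Subtype.mk.injEq, Prod.mk.injEq] at hne
      simp only at hij hkl
      have : ¬ (j = k ∧ i = l) := by rintro ⟨rfl, rfl⟩; exact hij.asymm hkl
      simp [elemAlt, hne, this]
    · simp
  have hspan : graphSpace F G =
      Submodule.span F (Set.range fun e : IncreasingEdge G => elemAlt F e.1.1 e.1.2) := by
    unfold graphSpace
    congr 1
    ext M
    constructor
    · rintro ⟨i, j, hij, h, rfl⟩
      exact ⟨⟨(i, j), hij, h⟩, rfl⟩
    · rintro ⟨⟨⟨i, j⟩, hij, h⟩, rfl⟩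
      exact ⟨i, j, hij, h, rfl⟩
  rw [hspan, finrank_span_eq_card hli, ← card_increasingEdge, Nat.card_eq_fintype_card]

/-- Two functionals whose alternating product vanishes on `U × W` are proportional on `U ⊔ W`,
as soon as the first of them vanishes neither on `U` nor on `W`. -/
theorem exists_eq_smul_of_mul_eq_mul {F V : Type*} [Field F] [AddCommGroup V] [Module F V]
    {U W : Submodule F V} {f g : V →ₗ[F] F} (h : ∀ u ∈ U, ∀ w ∈ W, f u * g w = g u * f w)
    (hU : ∃ u ∈ U, f u ≠ 0) (hW : ∃ w ∈ W, f w ≠ 0) :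
    ∃ t : F, ∀ v ∈ U ⊔ W, g v = t * f v := by
  obtain ⟨u₀, hu₀, hfu⟩ := hU
  obtain ⟨w₀, hw₀, hfw⟩ := hW
  have hw : ∀ w ∈ W, g w = g u₀ / f u₀ * f w := fun w hw => by
    have := h u₀ hu₀ w hw
    field_simp
    linear_combination this
  have hu : ∀ u ∈ U, g u = g u₀ / f u₀ * f u := fun u hu => by
    have h1 := h u hu w₀ hw₀
    rw [hw w₀ hw₀] at h1
    apply mul_right_cancel₀ hfw
    linear_combination -h1
  refine ⟨g u₀ / f u₀, fun v hv => ?_⟩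
  obtain ⟨u, huU, w, hwW, rfl⟩ := Submodule.mem_sup.1 hv
  rw [map_add, map_add, hu u huU, hw w hwW]
  ring

end LinearAlgebra

/-! ### Disconnectedness as bipartition -/

section Connectivity

theorem not_preconnected_iff {V : Type*} (H : SimpleGraph V) :
    ¬ H.Preconnected ↔
      ∃ L : Set V, L.Nonempty ∧ Lᶜ.Nonempty ∧ ∀ i ∈ L, ∀ j ∉ L, ¬ H.Adj i j := by
  constructor
  · intro h
    simp only [SimpleGraph.Preconnected, not_forall] at h
    obtain ⟨x, y, hxy⟩ := h
    exact ⟨{z | H.Reachable x z}, ⟨x, .refl x⟩, ⟨y, hxy⟩,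
      fun i hi j hj hij => hj (SimpleGraph.Reachable.trans hi hij.reachable)⟩
  · rintro ⟨L, ⟨x, hx⟩, ⟨y, hy⟩, hL⟩ h
    obtain ⟨w⟩ := h x y
    induction w with
    | nil => exact hy hx
    | cons hadj _ ih =>
      exact ih (by_contra fun hv => hL _ hx _ hv hadj) hy

/-- The graph of the edges of `G` that join `L` to its complement. -/
def crossing {V : Type*} (G : SimpleGraph V) (L : Set V) : SimpleGraph V where
  Adj i j := G.Adj i j ∧ ¬ (i ∈ L ↔ j ∈ L)
  symm := ⟨fun _ _ h => ⟨h.1.symm, fun e => h.2 e.symm⟩⟩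
  loopless := ⟨fun _ h => h.2 Iff.rfl⟩

theorem crossing_le {V : Type*} (G : SimpleGraph V) (L : Set V) : crossing G L ≤ G :=
  fun _ _ h => h.1

theorem ncard_crossing_mem_edgeCutSizes {n : ℕ} (G : SimpleGraph (Fin n)) {L : Set (Fin n)}
    (h : L.Nonempty) (h' : Lᶜ.Nonempty) : (crossing G L).edgeSet.ncard ∈ edgeCutSizes G := by
  classical
  refine ⟨(crossing G L).edgeFinset, ?_, ?_, ?_⟩
  · simpa using crossing_le G L
  · rw [Set.ncard_eq_toFinset_card']
    rfl
  · rw [not_preconnected_iff]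
    refine ⟨L, h, h', fun i hi j hj hadj => ?_⟩
    rw [SimpleGraph.deleteEdges_adj] at hadj
    apply hadj.2
    simp only [SimpleGraph.coe_edgeFinset, SimpleGraph.mem_edgeSet]
    exact ⟨hadj.1, fun e => hj (e.1 hi)⟩

/-- Phrased through the remaining vertices `Y` because `Y.ncard` is what gets matched with the
dimension of a subspace. -/
theorem mem_vertexSeparatorSizes_iff {n : ℕ} {G : SimpleGraph (Fin n)} {s : ℕ} :
    s ∈ vertexSeparatorSizes G ↔ ∃ Y L : Set (Fin n), Y.ncard + s = n ∧ L ⊆ Y ∧ L.Nonempty ∧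
      (Y \ L).Nonempty ∧ ∀ i ∈ L, ∀ j ∈ Y \ L, ¬ G.Adj i j := by
  classical
  constructor
  · rintro ⟨X, rfl, hX⟩
    rw [not_preconnected_iff] at hX
    obtain ⟨L, ⟨x, hx⟩, ⟨y, hy⟩, hL⟩ := hX
    refine ⟨{v | v ∉ X}, Subtype.val '' L, ?_, ?_, ⟨_, x, hx, rfl⟩, ⟨y, y.2, ?_⟩, ?_⟩
    · have : ({v | v ∉ X} : Set (Fin n)) = ((Xᶜ : Finset (Fin n)) : Set (Fin n)) := by ext; simp
      rw [this, Set.ncard_coe_finset, Finset.card_compl_add_card, Fintype.card_fin]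
    · rintro _ ⟨z, -, rfl⟩
      exact z.2
    · rintro ⟨z, hz, e⟩
      exact hy (Subtype.ext e ▸ hz)
    · rintro _ ⟨i, hi, rfl⟩ j ⟨hjX, hj⟩ hadj
      exact hL i hi ⟨j, hjX⟩ (fun h => hj ⟨_, h, rfl⟩) hadj
  · rintro ⟨Y, L, hs, hLY, ⟨x, hx⟩, ⟨y, hy, hyL⟩, hL⟩
    refine ⟨Y.toFinsetᶜ, ?_, ?_⟩
    · rw [Finset.card_compl, ← Set.ncard_eq_toFinset_card', Fintype.card_fin]
      omega
    · rw [not_preconnected_iff]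
      refine ⟨{z | z.1 ∈ L}, ⟨⟨x, by simpa using hLY hx⟩, hx⟩, ⟨⟨y, by simpa using hy⟩, hyL⟩, ?_⟩
      rintro i hi ⟨j, hjY⟩ hj hadj
      exact hL i hi j ⟨by simpa using hjY, hj⟩ hadj

end Connectivity

/-! ### From pairs of subspaces to vertex bipartitions -/

section Subspaces

/-- A decomposition of the whole space yields a bipartition of the vertices such that no non-zero
matrix of the crossing graph vanishes on the two parts of the decomposition. -/
theorem exists_crossing_separating {F : Type*} [Field F] {n : ℕ} (G : SimpleGraph (Fin n))
    (hn : 2 ≤ n) {U W : Submodule F (Fin n → F)} (hUW : U ⊔ W = ⊤) (hU : U ≠ ⊤) (hW : W ≠ ⊤) :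
    ∃ L : Set (Fin n), L.Nonempty ∧ Lᶜ.Nonempty ∧ ∀ A ∈ graphSpace F (crossing G L),
      (∀ u ∈ U, ∀ w ∈ W, u ⬝ᵥ A.mulVec w = 0) → A = 0 := by
  classical
  by_cases hex : ∃ a, (∃ u ∈ U, u a ≠ 0) ∧ ∃ w ∈ W, w a ≠ 0
  · obtain ⟨a, ha, ha'⟩ := hex
    have : Nontrivial (Fin n) := Fin.nontrivial_iff_two_le.2 hn
    obtain ⟨b, hb⟩ := exists_ne a
    refine ⟨{a}, Set.singleton_nonempty a, ⟨b, hb⟩, fun A hA hzero => ?_⟩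
    have hoff : ∀ i j, i ≠ a → j ≠ a → A i j = 0 := fun i j hi hj =>
      graphSpace_apply_eq_zero hA fun h => h.2 (by simp [hi, hj])
    have haa : A a a = 0 := graphSpace_apply_eq_zero hA (SimpleGraph.irrefl _)
    have hsw := graphSpace_apply_swap hA
    -- The crossing graph of `{a}` is a star, so `A` is determined by its row `r` at `a`: it equals
    -- `e_a rᵗ - r e_aᵗ`.
    have hform : A = Matrix.vecMulVec (Pi.single a 1) (A a) -
        Matrix.vecMulVec (A a) (Pi.single a 1) := by
      ext i j
      by_cases hi : i = a <;> by_cases hj : j = a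
      · subst hi; subst hj; simp [Matrix.vecMulVec_apply, haa]
      · subst hi; simp [Matrix.vecMulVec_apply, hj]
      · subst hj; simp [Matrix.vecMulVec_apply, hi, hsw j i]
      · simp [Matrix.vecMulVec_apply, hi, hj, hoff i j hi hj]
    have hval : ∀ u w : Fin n → F, u ⬝ᵥ A.mulVec w = u a * (A a ⬝ᵥ w) - (A a ⬝ᵥ u) * w a := by
      intro u w
      conv_lhs => rw [hform]
      simp [Matrix.sub_mulVec, Matrix.vecMulVec_mulVec, dotProduct_comm u]
      ring
    obtain ⟨t, ht⟩ := exists_eq_smul_of_mul_eq_mul (U := U) (W := W)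
      (f := LinearMap.proj a) (g := dotProductBilin F F (A a))
      (fun u hu w hw => by
        have := hzero u hu w hw
        rw [hval] at this
        simpa using sub_eq_zero.1 this) ha ha'
    rw [hUW] at ht
    have hrow : ∀ v, A a ⬝ᵥ v = t * v a := fun v => ht v trivial
    -- Row `a` is `t` times the coordinate `a`, but its diagonal entry is zero.
    have ht0 : t = 0 := by simpa [haa] using (hrow (Pi.single a 1)).symm
    have hAa : A a = 0 := by
      ext j
      simpa [ht0] using hrow (Pi.single j 1)
    rw [hform, hAa]
    ext i j
    simp
  · push Not at hex
    have hsum : ∀ v : Fin n → F, ∃ u ∈ U, ∃ w ∈ W, u + w = v := fun v =>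
      Submodule.mem_sup.1 (hUW ▸ Submodule.mem_top)
    set L : Set (Fin n) := {a | ∃ u ∈ U, u a ≠ 0} with hL
    have hLW : ∀ a ∈ L, ∀ w ∈ W, w a = 0 := fun a ha => hex a ha
    have hLU : ∀ a ∉ L, ∀ u ∈ U, u a = 0 := fun a ha u hu =>
      by_contra fun h => ha ⟨u, hu, h⟩
    -- Write `e_a = u + w`. On `L` every `w` vanishes; off `L` both `e_a` and `u` vanish, hence so
    -- does `w`. Thus `U` and `W` contain the coordinate subspaces of `L` and of its complement.
    have hmemU : ∀ a ∈ L, (Pi.single a 1 : Fin n → F) ∈ U := by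
      intro a ha
      obtain ⟨u, hu, w, hw, e⟩ := hsum (Pi.single a 1)
      have : w = 0 := by
        ext b
        by_cases hb : b ∈ L
        · exact hLW b hb w hw
        · have := congrFun e b
          rw [Pi.add_apply, hLU b hb u hu, Pi.single_eq_of_ne (ne_of_mem_of_not_mem ha hb).symm] at this
          simpa using this
      rw [← e, this, add_zero]
      exact hu
    have hmemW : ∀ a ∉ L, (Pi.single a 1 : Fin n → F) ∈ W := by
      intro a ha
      obtain ⟨u, hu, w, hw, e⟩ := hsum (Pi.single a 1)
      have : u = 0 := by
        ext b
        by_cases hb : b ∈ L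
        · have := congrFun e b
          rw [Pi.add_apply, hLW b hb w hw, Pi.single_eq_of_ne (ne_of_mem_of_not_mem hb ha)] at this
          simpa using this
        · exact hLU b hb u hu
      rw [← e, this, zero_add]
      exact hw
    have hspan : ∀ T : Submodule F (Fin n → F), (∀ a, Pi.single a 1 ∈ T) → T = ⊤ := by
      intro T hT
      rw [eq_top_iff, ← (Pi.basisFun F (Fin n)).span_eq, Submodule.span_le]
      rintro _ ⟨a, rfl⟩
      simpa using hT a
    refine ⟨L, ?_, ?_, fun A hA hzero => ?_⟩
    · rw [Set.nonempty_iff_ne_empty]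
      intro he
      exact hW (hspan W fun a => hmemW a (by simp [he]))
    · rw [Set.nonempty_compl]
      intro he
      exact hU (hspan U fun a => hmemU a (by simp [he]))
    · have hLR : ∀ i ∈ L, ∀ j ∉ L, A i j = 0 := fun i hi j hj => by
        simpa using hzero _ (hmemU i hi) _ (hmemW j hj)
      ext i j
      by_cases hi : i ∈ L <;> by_cases hj : j ∈ L
      · exact graphSpace_apply_eq_zero hA fun h => h.2 (by simp [hi, hj])
      · exact hLR i hi j hj
      · rw [graphSpace_apply_swap hA j i, hLR j hj i hi]; simp
      · exact graphSpace_apply_eq_zero hA fun h => h.2 (by simp [hi, hj])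

/-- Coordinates restricting to a basis of the dual of a subspace. -/
theorem exists_coordinates {F : Type*} [Field F] {n : ℕ} (S : Submodule F (Fin n → F)) :
    ∃ Y : Set (Fin n), Y.ncard = Module.finrank F S ∧
      (∀ v ∈ S, (∀ y ∈ Y, v y = 0) → v = 0) ∧
      ∀ y ∈ Y, ∀ z ∈ Y, y ≠ z → ∀ t : F, ¬ ∀ v ∈ S, v z = t * v y := by
  classical
  let e : Fin n → Module.Dual F S := fun i => (LinearMap.proj i).comp S.subtype
  -- A basis of the span of the restricted coordinates. A vector killed by it is killed by all
  -- coordinates, so the chosen ones separate `S`; hence there are exactly `finrank F S` of them.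
  obtain ⟨κ, a, ha, hspan, hli⟩ := exists_linearIndependent' F e
  have : Finite κ := Finite.of_injective a ha
  have := Fintype.ofFinite κ
  have hsep : ∀ v ∈ S, (∀ k, v (a k) = 0) → v = 0 := by
    intro v hv h
    have hle : Submodule.span F (Set.range e) ≤
        LinearMap.ker (Module.Dual.eval F S ⟨v, hv⟩) := by
      rw [← hspan, Submodule.span_le]
      rintro _ ⟨k, rfl⟩
      exact h k
    ext i
    exact hle (Submodule.subset_span ⟨i, rfl⟩)
  refine ⟨Set.range a, ?_, fun v hv h => hsep v hv fun k => h _ ⟨k, rfl⟩, ?_⟩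
  · rw [← Set.image_univ, Set.ncard_image_of_injective _ ha, Set.ncard_univ,
      Nat.card_eq_fintype_card]
    apply le_antisymm
    · have := hli.fintype_card_le_finrank
      rwa [Subspace.dual_finrank_eq] at this
    · let r : S →ₗ[F] (κ → F) := LinearMap.pi fun k => e (a k)
      have hr : Function.Injective r := by
        rw [← LinearMap.ker_eq_bot, LinearMap.ker_eq_bot']
        intro v hv
        exact Subtype.ext (hsep v v.2 fun k => congrFun hv k)
      simpa using LinearMap.finrank_le_finrank_of_injective hr
  · rintro _ ⟨k, rfl⟩ _ ⟨l, rfl⟩ hne t h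
    have hkl : k ≠ l := fun h => hne (h ▸ rfl)
    have hpair := hli.comp ![k, l] (by
      intro x y hxy
      fin_cases x <;> fin_cases y <;> simp_all)
    rw [Fintype.linearIndependent_iff] at hpair
    have := hpair ![t, -1] (by
      ext v
      simp [Fin.sum_univ_two, e, h v v.2]) 1
    simp at this

/-- An edge `i j` gives `u_i w_j = u_j w_i` on `U × W`. If it joined the two sides, coordinate `j`
would be a multiple of coordinate `i` on `U ⊔ W`, against the independence of the coordinates in
`Y`. Incomparability keeps both sides non-empty. -/
theorem exists_separation {F : Type*} [Field F] {n : ℕ} (G : SimpleGraph (Fin n))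
    {U W : Submodule F (Fin n → F)} (hUW : ¬ U ≤ W) (hWU : ¬ W ≤ U)
    (h : ∀ A ∈ graphSpace F G, ∀ u ∈ U, ∀ w ∈ W, u ⬝ᵥ A.mulVec w = 0) :
    ∃ Y L : Set (Fin n), Y.ncard = Module.finrank F ↥(U ⊔ W) ∧ L ⊆ Y ∧ L.Nonempty ∧
      (Y \ L).Nonempty ∧ ∀ i ∈ L, ∀ j ∈ Y \ L, ¬ G.Adj i j := by
  obtain ⟨Y, hcard, hsep, hindep⟩ := exists_coordinates (U ⊔ W)
  have hadj : ∀ i j, G.Adj i j → ∀ u ∈ U, ∀ w ∈ W, u i * w j = u j * w i := by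
    intro i j hij u hu w hw
    have := h _ (elemAlt_mem_graphSpace hij) u hu w hw
    rw [dotProduct_elemAlt_mulVec] at this
    exact sub_eq_zero.1 this
  by_cases hex : ∃ y ∈ Y, (∃ u ∈ U, u y ≠ 0) ∧ ∃ w ∈ W, w y ≠ 0
  · obtain ⟨y, hy, hU, hW⟩ := hex
    refine ⟨Y, {y}, hcard, by simpa using hy, Set.singleton_nonempty y, ?_, ?_⟩
    · by_contra hemp
      -- If `Y = {y}`, then `U ⊔ W` is a line, already spanned by some `u ∈ U`, so `W ≤ U`.
      have hY : ∀ z ∈ Y, z = y := fun z hz => by_contra fun hne => hemp ⟨z, hz, hne⟩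
      obtain ⟨u, hu, huy⟩ := hU
      apply hWU
      intro w hw
      have := hsep (w - (w y / u y) • u)
        (sub_mem (Submodule.mem_sup_right hw) (Submodule.mem_sup_left (U.smul_mem _ hu)))
        (fun z hz => by rw [hY z hz]; simp [huy])
      rw [sub_eq_zero.1 this]
      exact U.smul_mem _ hu
    · rintro i rfl j ⟨hj, hji⟩ hij
      obtain ⟨t, ht⟩ := exists_eq_smul_of_mul_eq_mul (U := U) (W := W)
        (f := LinearMap.proj i) (g := LinearMap.proj j) (hadj i j hij) hU hW
      exact hindep i hy j hj (fun e => hji e.symm) t ht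
  · push Not at hex
    refine ⟨Y, {y ∈ Y | ∃ u ∈ U, u y ≠ 0}, hcard, fun y hy => hy.1, ?_, ?_, ?_⟩
    · by_contra hemp
      apply hUW
      intro u hu
      rw [hsep u (Submodule.mem_sup_left hu) fun y hy =>
        by_contra fun hne => hemp ⟨y, hy, u, hu, hne⟩]
      exact W.zero_mem
    · by_contra hemp
      apply hWU
      intro w hw
      rw [hsep w (Submodule.mem_sup_right hw) fun y hy => by
        by_cases hyU : ∃ u ∈ U, u y ≠ 0
        · exact hex y hy hyU w hw
        · exact absurd ⟨y, hy, fun h' => hyU h'.2⟩ hemp]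
      exact U.zero_mem
    · rintro i ⟨hi, u, hu, hui⟩ j ⟨hj, hjL⟩ hij
      have hjU : ∀ u ∈ U, u j = 0 := fun u hu => by_contra fun hne => hjL ⟨hj, u, hu, hne⟩
      have hjW : ∀ w ∈ W, w j = 0 := fun w hw => by
        have := hadj i j hij u hu w hw
        rw [hjU u hu, zero_mul] at this
        exact (mul_eq_zero.1 this).resolve_left hui
      -- Coordinate `j` vanishes on both `U` and `W`: the excluded multiple is the zero one.
      refine hindep i hi j hj hij.ne 0 fun v hv => ?_
      obtain ⟨u, hu, w, hw, rfl⟩ := Submodule.mem_sup.1 hv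
      simp [hjU u hu, hjW w hw]

end Subspaces

/-! ### Commutators, regular subgroups and central decompositions -/

namespace BaerGroup

open scoped commutatorElement

section General

variable {p : ℕ} [Fact p.Prime] {n m : ℕ}
  {φ : (Fin n → ZMod p) →ₗ[ZMod p] (Fin n → ZMod p) →ₗ[ZMod p] (Fin m → ZMod p)}

theorem two_ne_zero_of_ne_two (hp : p ≠ 2) : (2 : ZMod p) ≠ 0 := by
  have : ((2 : ℕ) : ZMod p) ≠ 0 := by
    rw [Ne, ZMod.natCast_eq_zero_iff, Nat.prime_dvd_prime_iff_eq Fact.out Nat.prime_two]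
    exact hp
  exact_mod_cast this

/-- The image of a subgroup in the first component. -/
def fstImage (S : Subgroup (BaerGroup φ)) : Submodule (ZMod p) (Fin n → ZMod p) :=
  AddSubgroup.toZModSubmodule p
    { carrier := {v | ∃ g ∈ S, g.fst = v}
      zero_mem' := ⟨1, S.one_mem, rfl⟩
      add_mem' := by
        rintro _ _ ⟨g, hg, rfl⟩ ⟨h, hh, rfl⟩
        exact ⟨g * h, S.mul_mem hg hh, rfl⟩
      neg_mem' := by
        rintro _ ⟨g, hg, rfl⟩
        exact ⟨g⁻¹, S.inv_mem hg, rfl⟩ }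

/-- The part of a subgroup inside the second component. -/
def sndFiber (S : Subgroup (BaerGroup φ)) : Submodule (ZMod p) (Fin m → ZMod p) :=
  AddSubgroup.toZModSubmodule p
    { carrier := {z | (⟨0, z⟩ : BaerGroup φ) ∈ S}
      zero_mem' := S.one_mem
      add_mem' := by
        intro x y hx hy
        have := S.mul_mem hx hy
        have e : (⟨0, x⟩ * ⟨0, y⟩ : BaerGroup φ) = ⟨0, x + y⟩ := by
          ext1 <;> simp [fst_mul, snd_mul]
        rwa [e] at this
      neg_mem' := by
        intro x hx
        have := S.inv_mem hx
        have e : (⟨0, x⟩⁻¹ : BaerGroup φ) = ⟨0, -x⟩ := by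
          ext1 <;> simp [fst_inv, snd_inv]
        rwa [e] at this }

theorem mem_sndFiber {S : Subgroup (BaerGroup φ)} {z : Fin m → ZMod p} :
    z ∈ sndFiber S ↔ (⟨0, z⟩ : BaerGroup φ) ∈ S := Iff.rfl

/-- The subgroup of the pairs with components in two given subspaces. -/
def box (U : Submodule (ZMod p) (Fin n → ZMod p)) (Z : Submodule (ZMod p) (Fin m → ZMod p))
    (h : ∀ u ∈ U, ∀ u' ∈ U, φ u u' ∈ Z) : Subgroup (BaerGroup φ) where
  carrier := {g | g.fst ∈ U ∧ g.snd ∈ Z}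
  one_mem' := ⟨U.zero_mem, Z.zero_mem⟩
  mul_mem' := fun ha hb => ⟨U.add_mem ha.1 hb.1,
    Z.add_mem (Z.add_mem ha.2 hb.2) (Z.smul_mem _ (h _ ha.1 _ hb.1))⟩
  inv_mem' := fun ha => ⟨U.neg_mem ha.1,
    Z.add_mem (Z.neg_mem ha.2) (Z.smul_mem _ (h _ ha.1 _ ha.1))⟩

theorem fstImage_box (U : Submodule (ZMod p) (Fin n → ZMod p))
    (Z : Submodule (ZMod p) (Fin m → ZMod p)) (h : ∀ u ∈ U, ∀ u' ∈ U, φ u u' ∈ Z) :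
    fstImage (box U Z h) = U := by
  ext v
  constructor
  · rintro ⟨g, hg, rfl⟩
    exact hg.1
  · intro hv
    exact ⟨⟨v, 0⟩, ⟨hv, Z.zero_mem⟩, rfl⟩

theorem commutatorElement_eq (h2 : (2 : ZMod p) ≠ 0) (hφ : ∀ v, φ v v = 0) (g h : BaerGroup φ) :
    ⁅g, h⁆ = ⟨0, φ g.fst h.fst⟩ := by
  have hsw : φ h.fst g.fst = - φ g.fst h.fst := by
    have := hφ (g.fst + h.fst)
    simp only [map_add, LinearMap.add_apply, hφ, zero_add, add_zero] at this
    rw [eq_neg_iff_add_eq_zero, ← this]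
  rw [commutatorElement_def, mul_inv_eq_iff_eq_mul, mul_inv_eq_iff_eq_mul]
  ext1
  · simp [fst_mul, add_comm]
  · simp only [snd_mul, fst_mul, hsw, map_zero, LinearMap.zero_apply, zero_add]
    ext k
    simp only [Pi.add_apply, Pi.smul_apply, Pi.neg_apply, Pi.zero_apply, smul_eq_mul]
    field_simp
    ring

theorem mul_comm_iff (h2 : (2 : ZMod p) ≠ 0) (hφ : ∀ v, φ v v = 0) (g h : BaerGroup φ) :
    g * h = h * g ↔ φ g.fst h.fst = 0 := by
  rw [← commutatorElement_eq_one_iff_mul_comm, commutatorElement_eq h2 hφ]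
  exact ⟨fun e => congrArg BaerGroup.snd e, fun e => by rw [e]; rfl⟩

theorem pow_eq (hφ : ∀ v, φ v v = 0) (g : BaerGroup φ) (k : ℕ) :
    g ^ k = ⟨k • g.fst, k • g.snd⟩ := by
  induction k with
  | zero => rw [pow_zero, zero_smul, zero_smul]; rfl
  | succ k ih =>
    rw [pow_succ, ih]
    ext1
    · simp only [fst_mul, succ_nsmul]
    · simp only [snd_mul, succ_nsmul, map_nsmul, LinearMap.smul_apply, hφ, smul_zero, add_zero]

theorem pow_prime_eq_one (hφ : ∀ v, φ v v = 0) (g : BaerGroup φ) : g ^ p = 1 := by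
  rw [pow_eq hφ]
  ext1 <;> ext k <;> simp [fst_one, snd_one]

theorem span_le_sndFiber_commutator (h2 : (2 : ZMod p) ≠ 0) (hφ : ∀ v, φ v v = 0)
    (S : Subgroup (BaerGroup φ)) :
    Submodule.span (ZMod p) {z | ∃ u ∈ fstImage S, ∃ v ∈ fstImage S, φ u v = z} ≤
      sndFiber ⁅S, S⁆ := by
  rw [Submodule.span_le]
  rintro _ ⟨_, ⟨g, hg, rfl⟩, _, ⟨h, hh, rfl⟩, rfl⟩
  have := Subgroup.commutator_mem_commutator hg hh
  rwa [commutatorElement_eq h2 hφ] at this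

theorem mem_commutator_iff (h2 : (2 : ZMod p) ≠ 0) (hφ : ∀ v, φ v v = 0)
    (hspan : Submodule.span (ZMod p) {z | ∃ u v, φ u v = z} = ⊤) {g : BaerGroup φ} :
    g ∈ commutator (BaerGroup φ) ↔ g.fst = 0 := by
  rw [_root_.commutator_def]
  constructor
  · intro hg
    have hle : ⁅(⊤ : Subgroup (BaerGroup φ)), ⊤⁆ ≤ 
        box (φ := φ) ⊥ ⊤ (fun _ _ _ _ => trivial) := by
      rw [Subgroup.commutator_le]
      intro x _ y _
      rw [commutatorElement_eq h2 hφ]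
      exact ⟨Submodule.zero_mem _, trivial⟩
    exact (hle hg).1
  · intro hg
    have hle := span_le_sndFiber_commutator h2 hφ (⊤ : Subgroup (BaerGroup φ))
    have htop : ∀ v, v ∈ fstImage (⊤ : Subgroup (BaerGroup φ)) := fun v => ⟨⟨v, 0⟩, trivial, rfl⟩
    simp only [htop, true_and, hspan] at hle
    have : (⟨0, g.snd⟩ : BaerGroup φ) ∈ ⁅(⊤ : Subgroup (BaerGroup φ)), ⊤⁆ :=
      mem_sndFiber.1 (hle trivial)
    rwa [← hg] at this

theorem commutator_le_center (h2 : (2 : ZMod p) ≠ 0) (hφ : ∀ v, φ v v = 0)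
    (hspan : Submodule.span (ZMod p) {z | ∃ u v, φ u v = z} = ⊤) :
    commutator (BaerGroup φ) ≤ Subgroup.center (BaerGroup φ) := by
  intro g hg
  rw [Subgroup.mem_center_iff]
  intro h
  rw [mul_comm_iff h2 hφ, (mem_commutator_iff h2 hφ hspan).1 hg, map_zero]

/-- A subgroup of a regular subgroup `S` with the same first component is the whole of `S`. -/
theorem le_of_fstImage_le (h2 : (2 : ZMod p) ≠ 0) (hφ : ∀ v, φ v v = 0)
    (hspan : Submodule.span (ZMod p) {z | ∃ u v, φ u v = z} = ⊤) {S J : Subgroup (BaerGroup φ)}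
    (hS : IsRegular S) (hJS : J ≤ S) (h : fstImage S ≤ fstImage J) : S ≤ J := by
  -- Commutators depend only on first components, so `J` already produces all those of `S`. Elements
  -- of `S` and `J` with equal first component then differ by an element of `S ⊓ [P,P] = [S,S]`.
  have hcomm : ⁅S, S⁆ ≤ J := by
    rw [Subgroup.commutator_le]
    intro a ha b hb
    obtain ⟨a', ha', ea⟩ := h ⟨a, ha, rfl⟩
    obtain ⟨b', hb', eb⟩ := h ⟨b, hb, rfl⟩
    rw [commutatorElement_eq h2 hφ, ← ea, ← eb, ← commutatorElement_eq h2 hφ]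
    exact Subgroup.commutator_le_self J (Subgroup.commutator_mem_commutator ha' hb')
  intro a ha
  obtain ⟨a', ha', ea⟩ := h ⟨a, ha, rfl⟩
  have : a'⁻¹ * a ∈ J := by
    apply hcomm
    rw [hS]
    refine Subgroup.mem_inf.2 ⟨S.mul_mem (S.inv_mem (hJS ha')) ha, ?_⟩
    rw [mem_commutator_iff h2 hφ hspan, fst_mul, fst_inv, ea, neg_add_cancel]
  simpa using J.mul_mem ha' this

theorem isRegular_of_le {P : Type*} [Group P] {S : Subgroup P} (h : S ⊓ commutator P ≤ ⁅S, S⁆) :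
    IsRegular S :=
  le_antisymm (le_inf (Subgroup.commutator_le_self S) (by
    rw [_root_.commutator_def]
    exact Subgroup.commutator_mono le_top le_top)) h

/-- Regularity says precisely that the kernel of the first projection on `S`, namely `S ⊓ [P,P]`, is
`[S,S]`. -/
theorem natCard_quotient_commutator (h2 : (2 : ZMod p) ≠ 0) (hφ : ∀ v, φ v v = 0)
    (hspan : Submodule.span (ZMod p) {z | ∃ u v, φ u v = z} = ⊤) {S : Subgroup (BaerGroup φ)}
    (hS : IsRegular S) :
    Nat.card (S ⧸ commutator S) = p ^ Module.finrank (ZMod p) (fstImage S) := by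
  let f : S →* Multiplicative (Fin n → ZMod p) :=
    { toFun := fun g => Multiplicative.ofAdd g.1.fst
      map_one' := rfl
      map_mul' := fun _ _ => rfl }
  have hker : f.ker = commutator S := by
    apply Subgroup.map_injective S.subtype_injective
    rw [Subgroup.map_subtype_commutator, hS]
    ext g
    simp only [Subgroup.mem_map, Subgroup.mem_inf, mem_commutator_iff h2 hφ hspan]
    constructor
    · rintro ⟨x, hx, rfl⟩
      exact ⟨x.2, hx⟩
    · rintro ⟨hg, h0⟩
      exact ⟨⟨g, hg⟩, h0, rfl⟩
  rw [← hker, Nat.card_congr (QuotientGroup.quotientKerEquivRange f).toEquiv]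
  have : Nat.card f.range = Nat.card (fstImage S) := by
    refine Nat.card_congr (Equiv.subtypeEquiv Multiplicative.toAdd fun v => ?_)
    constructor
    · rintro ⟨g, rfl⟩
      exact ⟨g, g.2, rfl⟩
    · rintro ⟨g, hg, e⟩
      exact ⟨⟨g, hg⟩, e⟩
  rw [this, Module.natCard_eq_pow_finrank (K := ZMod p), Nat.card_zmod]

theorem natCard_eq_of_fst_eq_zero {N : Subgroup (BaerGroup φ)} (hN : ∀ g ∈ N, g.fst = 0) :
    Nat.card N = p ^ Module.finrank (ZMod p) (sndFiber N) := by
  have : Nat.card N = Nat.card (sndFiber N) := by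
    refine Nat.card_eq_of_bijective
      (fun g => (⟨g.1.snd, by
        rw [mem_sndFiber, ← hN g.1 g.2]
        exact g.2⟩ : sndFiber N)) ⟨?_, ?_⟩
    · rintro ⟨g, hg⟩ ⟨h, hh⟩ e
      exact Subtype.ext (BaerGroup.ext ((hN g hg).trans (hN h hh).symm) (congrArg Subtype.val e))
    · rintro ⟨z, hz⟩
      exact ⟨⟨_, hz⟩, rfl⟩
  rw [this, Module.natCard_eq_pow_finrank (K := ZMod p), Nat.card_zmod]

theorem sup_fstImage {S J K : Subgroup (BaerGroup φ)} (hJ : J ≤ S) (hK : K ≤ S)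
    (h : ∀ g ∈ S, ∃ j ∈ J, ∃ k ∈ K, g.fst = j.fst + k.fst) :
    fstImage J ⊔ fstImage K = fstImage S := by
  apply le_antisymm
  · refine sup_le ?_ ?_
    · rintro _ ⟨g, hg, rfl⟩
      exact ⟨g, hJ hg, rfl⟩
    · rintro _ ⟨g, hg, rfl⟩
      exact ⟨g, hK hg, rfl⟩
  · rintro _ ⟨g, hg, rfl⟩
    obtain ⟨j, hj, k, hk, e⟩ := h g hg
    rw [e]
    exact Submodule.add_mem_sup ⟨j, hj, rfl⟩ ⟨k, hk, rfl⟩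

/-- A central decomposition of a regular subgroup gives two incomparable subspaces that span its
first component and are orthogonal for `φ`. -/
theorem exists_orthogonal_of_centrallyDecomposable (h2 : (2 : ZMod p) ≠ 0)
    (hφ : ∀ v, φ v v = 0) (hspan : Submodule.span (ZMod p) {z | ∃ u v, φ u v = z} = ⊤)
    {S : Subgroup (BaerGroup φ)} (hS : IsRegular S) (hdec : CentrallyDecomposable S) :
    ∃ U W : Submodule (ZMod p) (Fin n → ZMod p), U ⊔ W = fstImage S ∧ ¬ U ≤ W ∧ ¬ W ≤ U ∧
      ∀ u ∈ U, ∀ w ∈ W, φ u w = 0 := by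
  obtain ⟨J, K, -, hJ, -, hK, hcomm, hgen⟩ := hdec
  -- Proper factors keep proper projections; as the two projections span, neither can contain the
  -- other.
  have hproper : ∀ J : Subgroup S, J ≠ ⊤ → ¬ fstImage S ≤ fstImage (J.map S.subtype) := by
    intro J hJ h
    have hle := le_of_fstImage_le h2 hφ hspan hS (Subgroup.map_subtype_le J) h
    apply hJ
    rw [eq_top_iff]
    rintro ⟨x, hx⟩ -
    obtain ⟨y, hy, e⟩ := hle hx
    have : y = ⟨x, hx⟩ := Subtype.ext e
    rwa [← this]
  have hsup : fstImage (J.map S.subtype) ⊔ fstImage (K.map S.subtype) = fstImage S := by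
    refine sup_fstImage (Subgroup.map_subtype_le J) (Subgroup.map_subtype_le K) fun g hg => ?_
    obtain ⟨j, hj, k, hk, e⟩ := hgen ⟨g, hg⟩
    exact ⟨j, ⟨j, hj, rfl⟩, k, ⟨k, hk, rfl⟩, congrArg (fun x : S => x.1.fst) e⟩
  refine ⟨_, _, hsup, fun hle => hproper K hK ?_, fun hle => hproper J hJ ?_, ?_⟩
  · rw [← hsup, sup_eq_right.2 hle]
  · rw [← hsup, sup_eq_left.2 hle]
  · rintro _ ⟨_, ⟨j, hj, rfl⟩, rfl⟩ _ ⟨_, ⟨k, hk, rfl⟩, rfl⟩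
    exact (mul_comm_iff h2 hφ _ _).1 (congrArg Subtype.val (hcomm j hj k hk))

/-- A central decomposition of a quotient by a central subgroup `N` gives a decomposition of the
first component that is orthogonal for `φ` modulo `N`. -/
theorem exists_orthogonal_of_centrallyDecomposable_quotient (h2 : (2 : ZMod p) ≠ 0)
    (hφ : ∀ v, φ v v = 0) (hspan : Submodule.span (ZMod p) {z | ∃ u v, φ u v = z} = ⊤)
    {N : Subgroup (BaerGroup φ)} [N.Normal] (hN : ∀ g ∈ N, g.fst = 0)
    (hdec : CentrallyDecomposable (BaerGroup φ ⧸ N)) :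
    ∃ U W : Submodule (ZMod p) (Fin n → ZMod p), U ⊔ W = ⊤ ∧ U ≠ ⊤ ∧ W ≠ ⊤ ∧
      ∀ u ∈ U, ∀ w ∈ W, φ u w ∈ sndFiber N := by
  obtain ⟨J, K, -, hJ, -, hK, hcomm, hgen⟩ := hdec
  have hreg : IsRegular (⊤ : Subgroup (BaerGroup φ)) := by
    apply isRegular_of_le
    rw [top_inf_eq, _root_.commutator_def]
  have hproper : ∀ J : Subgroup (BaerGroup φ ⧸ N), J ≠ ⊤ →
      fstImage (J.comap (QuotientGroup.mk' N)) ≠ ⊤ := by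
    intro J hJ h
    have hle := le_of_fstImage_le h2 hφ hspan hreg (J := J.comap (QuotientGroup.mk' N)) le_top
      (by rw [h]; exact le_top)
    apply hJ
    rw [eq_top_iff]
    intro x _
    obtain ⟨y, rfl⟩ := QuotientGroup.mk'_surjective N x
    exact hle (Subgroup.mem_top y)
  refine ⟨_, _, ?_, hproper J hJ, hproper K hK, ?_⟩
  · rw [sup_fstImage (S := ⊤) le_top le_top]
    · rw [eq_top_iff]
      intro v _
      exact ⟨⟨v, 0⟩, trivial, rfl⟩
    · intro g _
      obtain ⟨j, hj, k, hk, e⟩ := hgen (QuotientGroup.mk' N g)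
      obtain ⟨j, rfl⟩ := QuotientGroup.mk'_surjective N j
      obtain ⟨k, rfl⟩ := QuotientGroup.mk'_surjective N k
      refine ⟨j, hj, k, hk, ?_⟩
      rw [← map_mul] at e
      have := hN _ (QuotientGroup.eq.1 e)
      rw [fst_mul, fst_inv, fst_mul] at this
      exact (neg_add_eq_zero.1 this)
  · rintro _ ⟨j, hj, rfl⟩ _ ⟨k, hk, rfl⟩
    have := hcomm _ hj _ hk
    rw [← commutatorElement_eq_one_iff_mul_comm, ← map_commutatorElement,
      commutatorElement_eq h2 hφ] at this
    exact (QuotientGroup.eq_one_iff _).1 this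

end General

end BaerGroup

/-! ### Coordinate subspaces -/

section CoordinateSubspaces

/-- The vectors supported on a set of coordinates. -/
noncomputable def supported (F : Type*) [Field F] {n : ℕ} (Y : Set (Fin n)) : Submodule F (Fin n → F) :=
  ⨅ i ∈ Yᶜ, LinearMap.ker (LinearMap.proj i : (Fin n → F) →ₗ[F] F)

theorem mem_supported {F : Type*} [Field F] {n : ℕ} {Y : Set (Fin n)} {v : Fin n → F} :
    v ∈ supported F Y ↔ ∀ i ∉ Y, v i = 0 := by
  simp [supported, Submodule.mem_iInf]

theorem single_mem_supported {F : Type*} [Field F] {n : ℕ} {Y : Set (Fin n)} {i : Fin n} :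
    (Pi.single i 1 : Fin n → F) ∈ supported F Y ↔ i ∈ Y := by
  rw [mem_supported]
  constructor
  · intro h
    by_contra hi
    simpa using h i hi
  · intro hi j hj
    exact Pi.single_eq_of_ne (ne_of_mem_of_not_mem hi hj).symm 1

theorem supported_mono (F : Type*) [Field F] {n : ℕ} {Y Z : Set (Fin n)} (h : Y ⊆ Z) :
    supported F Y ≤ supported F Z := fun _ hv =>
  mem_supported.2 fun i hi => mem_supported.1 hv i fun h' => hi (h h')

theorem finrank_supported (F : Type*) [Field F] {n : ℕ} (Y : Set (Fin n)) :
    Module.finrank F (supported F Y) = Y.ncard := by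
  classical
  rw [supported, (LinearMap.iInfKerProjEquiv F (fun _ : Fin n => F) (I := Y) (J := Yᶜ)
    disjoint_compl_right (by simp)).finrank_eq, Module.finrank_fintype_fun_eq_card,
    ← Nat.card_eq_fintype_card, Nat.card_coe_set_eq]

/-- A vector supported on `Y` is the sum of its restrictions to `L` and to `Y \ L`. -/
theorem exists_add_of_mem_supported {F : Type*} [Field F] {n : ℕ} {Y : Set (Fin n)}
    (L : Set (Fin n)) {v : Fin n → F} (hv : v ∈ supported F Y) :
    ∃ u ∈ supported F L, ∃ w ∈ supported F (Y \ L), u + w = v := by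
  classical
  refine ⟨fun i => if i ∈ L then v i else 0, mem_supported.2 fun i hi => by simp [hi],
    fun i => if i ∈ L then 0 else v i, mem_supported.2 fun i hi => ?_, ?_⟩
  · by_cases hL : i ∈ L
    · simp [hL]
    · simpa [hL] using mem_supported.1 hv i fun h => hi ⟨h, hL⟩
  · ext i
    by_cases hL : i ∈ L <;> simp [hL]

theorem dotProduct_mulVec_eq_zero_of_not_adj {F : Type*} [Field F] {n : ℕ}
    {G : SimpleGraph (Fin n)} {A : Matrix (Fin n) (Fin n) F} (hA : A ∈ graphSpace F G)
    {L R : Set (Fin n)} (hLR : ∀ i ∈ L, ∀ j ∈ R, ¬ G.Adj i j) {u w : Fin n → F}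
    (hu : u ∈ supported F L) (hw : w ∈ supported F R) : u ⬝ᵥ A.mulVec w = 0 := by
  refine Finset.sum_eq_zero fun i _ => ?_
  by_cases hi : i ∈ L
  · refine mul_eq_zero_of_right _ ?_
    rw [Matrix.mulVec, dotProduct]
    refine Finset.sum_eq_zero fun j _ => ?_
    by_cases hj : j ∈ R
    · rw [graphSpace_apply_eq_zero hA (hLR i hi j hj), zero_mul]
    · rw [mem_supported.1 hw j hj, mul_zero]
  · rw [mem_supported.1 hu i hi, zero_mul]

end CoordinateSubspaces

/-! ### The form of a graph and duality -/

section GraphForm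

variable {F : Type*} [Field F] {n m : ℕ} {G : SimpleGraph (Fin n)}

/-- The bilinear map of an ordered basis of `𝒜_G`. -/
noncomputable abbrev graphForm (b : Module.Basis (Fin m) F (graphSpace F G)) :
    (Fin n → F) →ₗ[F] (Fin n → F) →ₗ[F] (Fin m → F) :=
  tupleBilin fun k => (b k : Matrix (Fin n) (Fin n) F)

/-- The basis identifies `F^m` with the dual of `𝒜_G`; under it `φ(v, u)` is the evaluation `A ↦
vᵗAu`, which removes the dependence on the basis. -/
theorem constr_graphForm (b : Module.Basis (Fin m) F (graphSpace F G)) (v u : Fin n → F)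
    (A : graphSpace F G) : b.constr F (graphForm b v u) A = v ⬝ᵥ A.1.mulVec u := by
  let ev : graphSpace F G →ₗ[F] F :=
    { toFun := fun A => v ⬝ᵥ A.1.mulVec u
      map_add' := fun A B => by simp [Matrix.add_mulVec, dotProduct_add]
      map_smul' := fun c A => by simp [Matrix.smul_mulVec, dotProduct_smul] }
  have : b.constr F (graphForm b v u) = ev := b.ext fun k => by
    rw [Module.Basis.constr_basis]
    rfl
  exact congrArg (fun f => f A) this

theorem graphForm_eq_zero_iff (b : Module.Basis (Fin m) F (graphSpace F G))
    {v u : Fin n → F} :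
    graphForm b v u = 0 ↔ ∀ A ∈ graphSpace F G, v ⬝ᵥ A.mulVec u = 0 := by
  rw [← (b.constr F).map_eq_zero_iff]
  constructor
  · intro h A hA
    rw [← constr_graphForm b v u ⟨A, hA⟩, h, LinearMap.zero_apply]
  · intro h
    ext A
    rw [constr_graphForm]
    exact h A.1 A.2

theorem graphForm_self (b : Module.Basis (Fin m) F (graphSpace F G)) (v : Fin n → F) :
    graphForm b v v = 0 :=
  (graphForm_eq_zero_iff b).2 fun _ hA => dotProduct_mulVec_self_of_mem_graphSpace hA v

/-- A functional `f` killing all values gives `A = ∑ f(e_k) A_k` with `uᵗAv = f(φ(u, v)) = 0`. So `A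
= 0`, and independence of the `A_k` gives `f = 0`. -/
theorem span_graphForm (b : Module.Basis (Fin m) F (graphSpace F G)) :
    Submodule.span F {z | ∃ u v, graphForm b u v = z} = ⊤ := by
  by_contra hne
  obtain ⟨f, hf, hle⟩ := Submodule.exists_le_ker_of_lt_top _ (lt_top_iff_ne_top.2 hne)
  apply hf
  have hsum : ∀ z : Fin m → F, f z = ∑ k, z k * f (Pi.single k 1) := fun z => by
    conv_lhs => rw [← (Pi.basisFun F (Fin m)).sum_repr z]
    simp
  set A : graphSpace F G := ∑ k, f (Pi.single k 1) • b k with hA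
  have hrepr : ∀ u v, u ⬝ᵥ A.1.mulVec v = 0 := fun u v => by
    rw [← constr_graphForm b u v A, hA, map_sum]
    have : f (graphForm b u v) = 0 := hle (Submodule.subset_span ⟨u, v, rfl⟩)
    rw [hsum] at this
    rw [← this]
    refine Finset.sum_congr rfl fun k _ => ?_
    rw [map_smul, Module.Basis.constr_basis, smul_eq_mul, mul_comm]
  have hA0 : A = 0 := by
    ext i j
    simpa using hrepr (Pi.single i 1) (Pi.single j 1)
  have hc := Fintype.linearIndependent_iff.1 b.linearIndependent _ (hA.symm.trans hA0)
  ext z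
  simp [hc]

/-- The vectors of `F^m` on which the matrices of a subgraph vanish. -/
noncomputable def annihilator (b : Module.Basis (Fin m) F (graphSpace F G)) (H : SimpleGraph (Fin n)) :
    Submodule F (Fin m → F) :=
  ((graphSpace F H).submoduleOf (graphSpace F G)).dualAnnihilator.map
    (b.constr F (M' := F)).symm.toLinearMap

theorem graphForm_mem_annihilator_iff (b : Module.Basis (Fin m) F (graphSpace F G))
    {H : SimpleGraph (Fin n)} (hH : H ≤ G) {u w : Fin n → F} :
    graphForm b u w ∈ annihilator b H ↔ ∀ A ∈ graphSpace F H, u ⬝ᵥ A.mulVec w = 0 := by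
  unfold annihilator
  rw [Submodule.mem_map_equiv, LinearEquiv.symm_symm, Submodule.mem_dualAnnihilator]
  constructor
  · intro h A hA
    have := h ⟨A, graphSpace_mono F hH hA⟩ hA
    rwa [constr_graphForm] at this
  · intro h A hA
    rw [constr_graphForm]
    exact h A.1 hA

theorem finrank_annihilator (b : Module.Basis (Fin m) F (graphSpace F G))
    {H : SimpleGraph (Fin n)} (hH : H ≤ G) :
    H.edgeSet.ncard + Module.finrank F (annihilator b H) = m := by
  have h := Subspace.finrank_add_finrank_dualAnnihilator_eq
    ((graphSpace F H).submoduleOf (graphSpace F G))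
  rw [(Submodule.submoduleOfEquivOfLe (graphSpace_mono F hH)).finrank_eq, finrank_graphSpace,
    Module.finrank_eq_card_basis b, Fintype.card_fin] at h
  unfold annihilator
  rwa [LinearEquiv.finrank_map_eq]

/-- If the matrices of a subgraph `H` are separated by a family of pairs of vectors whose values
under the form lie in `N`, then `N` has at least as many dimensions as `H` has edges. -/
theorem ncard_edgeSet_le_finrank (b : Module.Basis (Fin m) F (graphSpace F G))
    {H : SimpleGraph (Fin n)} (hH : H ≤ G) {N : Submodule F (Fin m → F)}
    {U W : Submodule F (Fin n → F)} (hN : ∀ u ∈ U, ∀ w ∈ W, graphForm b u w ∈ N)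
    (hsep : ∀ A ∈ graphSpace F H, (∀ u ∈ U, ∀ w ∈ W, u ⬝ᵥ A.mulVec w = 0) → A = 0) :
    H.edgeSet.ncard ≤ Module.finrank F N := by
  -- A matrix of `H` acts on `N` through the identification of `F^m` with the dual of `𝒜_G`.
  let ev : graphSpace F H →ₗ[F] Module.Dual F N :=
    N.subtype.dualMap ∘ₗ (b.constr F (M' := F)).toLinearMap.flip ∘ₗ
      Submodule.inclusion (graphSpace_mono F hH)
  have hev : Function.Injective ev := by
    rw [← LinearMap.ker_eq_bot, LinearMap.ker_eq_bot']
    intro A hA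
    refine Subtype.ext (hsep A A.2 fun u hu w hw => ?_)
    have : ev A ⟨_, hN u hu w hw⟩ = 0 := by rw [hA]; rfl
    exact (constr_graphForm b u w (Submodule.inclusion (graphSpace_mono F hH) A)).symm.trans this
  have := LinearMap.finrank_le_finrank_of_injective hev
  rwa [finrank_graphSpace, Subspace.dual_finrank_eq] at this

end GraphForm

/-! ### Comparison of the graph and group parameters -/

section GraphGroup

open BaerGroup
open scoped commutatorElement

variable {p : ℕ} [Fact p.Prime] {n m : ℕ} {G : SimpleGraph (Fin n)}

theorem natCard_commutator_graphGroup (h2 : (2 : ZMod p) ≠ 0)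
    (b : Module.Basis (Fin m) (ZMod p) (graphSpace (ZMod p) G)) :
    Nat.card (commutator (graphGroup p G b)) = p ^ m := by
  rw [natCard_eq_of_fst_eq_zero fun g hg =>
    (mem_commutator_iff h2 (graphForm_self b) (span_graphForm b)).1 hg]
  have : sndFiber (commutator (graphGroup p G b)) = ⊤ := by
    rw [eq_top_iff]
    intro z _
    rw [mem_sndFiber, mem_commutator_iff h2 (graphForm_self b) (span_graphForm b)]
  rw [this, finrank_top, Module.finrank_fintype_fun_eq_card, Fintype.card_fin]

theorem isB_graphGroup (h2 : (2 : ZMod p) ≠ 0)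
    (b : Module.Basis (Fin m) (ZMod p) (graphSpace (ZMod p) G)) {i j : Fin n} (hij : G.Adj i j) :
    IsB p n m (graphGroup p G b) where
  nonabelian := by
    refine ⟨⟨Pi.single i 1, 0⟩, ⟨Pi.single j 1, 0⟩, fun h => ?_⟩
    rw [mul_comm_iff h2 (graphForm_self b), graphForm_eq_zero_iff] at h
    have := h _ (elemAlt_mem_graphSpace hij)
    rw [dotProduct_elemAlt_mulVec] at this
    simp [hij.ne'] at this
  exponent := pow_prime_eq_one (graphForm_self b)
  class_two := commutator_le_center h2 (graphForm_self b) (span_graphForm b)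
  card_quotient := by
    let f : graphGroup p G b →* Multiplicative (Fin n → ZMod p) :=
      { toFun := fun g => Multiplicative.ofAdd g.fst
        map_one' := rfl
        map_mul' := fun _ _ => rfl }
    have hker : f.ker = commutator (graphGroup p G b) := by
      ext g
      rw [mem_commutator_iff h2 (graphForm_self b) (span_graphForm b)]
      rfl
    rw [← hker, Nat.card_congr (QuotientGroup.quotientKerEquivOfSurjective f
      fun v => ⟨⟨v.toAdd, 0⟩, rfl⟩).toEquiv, Nat.card_congr Multiplicative.toAdd]
    simp
  card_commutator := natCard_commutator_graphGroup h2 b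

theorem mem_vertexSeparatorSizes_of_mem_strictKappaSet (h2 : (2 : ZMod p) ≠ 0)
    (b : Module.Basis (Fin m) (ZMod p) (graphSpace (ZMod p) G)) {s : ℕ}
    (h : s ∈ strictKappaSet p n (graphGroup p G b)) : s ∈ vertexSeparatorSizes G := by
  obtain ⟨hs, S, hS, hcard, hdec⟩ := h
  rw [natCard_quotient_commutator h2 (graphForm_self b) (span_graphForm b) hS] at hcard
  have hfin := Nat.pow_right_injective (Fact.out : p.Prime).two_le hcard
  obtain ⟨U, W, hsup, hUW, hWU, horth⟩ := exists_orthogonal_of_centrallyDecomposable h2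
    (graphForm_self b) (span_graphForm b) hS hdec
  obtain ⟨Y, L, hY, hL⟩ := exists_separation G hUW hWU fun A hA u hu w hw =>
    (graphForm_eq_zero_iff b).1 (horth u hu w hw) A hA
  rw [hsup, hfin] at hY
  exact mem_vertexSeparatorSizes_iff.2 ⟨Y, L, by omega, hL⟩

theorem mem_strictKappaSet_of_mem_vertexSeparatorSizes (h2 : (2 : ZMod p) ≠ 0)
    (b : Module.Basis (Fin m) (ZMod p) (graphSpace (ZMod p) G)) {s : ℕ}
    (h : s ∈ vertexSeparatorSizes G) : s ∈ strictKappaSet p n (graphGroup p G b) := by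
  obtain ⟨Y, L, hs, hLY, ⟨i, hi⟩, ⟨j, hj⟩, hadj⟩ := mem_vertexSeparatorSizes_iff.1 h
  -- The smallest admissible second component: it lies in `[S,S]`, which makes `S` regular.
  set Z : Submodule (ZMod p) (Fin m → ZMod p) := Submodule.span (ZMod p)
    {z | ∃ u ∈ supported (ZMod p) Y, ∃ v ∈ supported (ZMod p) Y, graphForm b u v = z}
  have hZ : ∀ u ∈ supported (ZMod p) Y, ∀ v ∈ supported (ZMod p) Y, graphForm b u v ∈ Z :=
    fun u hu v hv => Submodule.subset_span ⟨u, hu, v, hv, rfl⟩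
  have hZ' : ∀ T ⊆ Y, ∀ u ∈ supported (ZMod p) T, ∀ v ∈ supported (ZMod p) T,
      graphForm b u v ∈ Z := fun T hT u hu v hv =>
    hZ u (supported_mono _ hT hu) v (supported_mono _ hT hv)
  let S : Subgroup (graphGroup p G b) := box (supported (ZMod p) Y) Z hZ
  have hreg : IsRegular S := by
    refine isRegular_of_le fun g hg => ?_
    obtain ⟨hgS, hgc⟩ := Subgroup.mem_inf.1 hg
    have hle := span_le_sndFiber_commutator h2 (graphForm_self b) S
    rw [fstImage_box] at hle
    have := mem_sndFiber.1 (hle hgS.2)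
    rwa [← (mem_commutator_iff h2 (graphForm_self b) (span_graphForm b)).1 hgc] at this
  have hbox : ∀ T (hT : T ⊆ Y) (k l : Fin n), k ∈ T → l ∈ Y → l ∉ T →
      (box (supported (ZMod p) T) Z (hZ' T hT)).subgroupOf S ≠ ⊥ ∧
      (box (supported (ZMod p) T) Z (hZ' T hT)).subgroupOf S ≠ ⊤ := by
    intro T hT k l hk hl hlT
    have hmem : ∀ x ∈ Y, (⟨Pi.single x 1, 0⟩ : graphGroup p G b) ∈ S := fun x hx =>
      ⟨single_mem_supported.2 hx, Z.zero_mem⟩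
    constructor
    · intro e
      have hk' : (⟨⟨Pi.single k 1, 0⟩, hmem k (hT hk)⟩ : S) ∈
          (box (supported (ZMod p) T) Z (hZ' T hT)).subgroupOf S :=
        ⟨single_mem_supported.2 hk, Z.zero_mem⟩
      rw [e, Subgroup.mem_bot] at hk'
      have := congrFun (congrArg (fun x : S => x.1.fst) hk') k
      simp [fst_one] at this
    · intro e
      have hl' : (⟨⟨Pi.single l 1, 0⟩, hmem l hl⟩ : S) ∈
          (box (supported (ZMod p) T) Z (hZ' T hT)).subgroupOf S := by
        rw [e]; trivial
      exact hlT (single_mem_supported.1 hl'.1)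
  refine ⟨by omega, S, hreg, ?_, _, _, (hbox L hLY i j hi hj.1 hj.2).1,
    (hbox L hLY i j hi hj.1 hj.2).2, (hbox (Y \ L) Set.sdiff_subset j i hj (hLY hi) (by simp [hi])).1,
    (hbox (Y \ L) Set.sdiff_subset j i hj (hLY hi) (by simp [hi])).2, ?_, ?_⟩
  · rw [natCard_quotient_commutator h2 (graphForm_self b) (span_graphForm b) hreg, fstImage_box,
      finrank_supported]
    congr 1
    omega
  · rintro ⟨x, hx⟩ hxL ⟨y, hy⟩ hyL
    refine Subtype.ext ((mul_comm_iff h2 (graphForm_self b) x y).2 ?_)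
    exact (graphForm_eq_zero_iff b).2 fun A hA =>
      dotProduct_mulVec_eq_zero_of_not_adj hA hadj hxL.1 hyL.1
  · rintro ⟨x, hx⟩
    obtain ⟨u, hu, w, hw, e⟩ := exists_add_of_mem_supported L hx.1
    have hcross : graphForm b u w = 0 := (graphForm_eq_zero_iff b).2 fun A hA =>
      dotProduct_mulVec_eq_zero_of_not_adj hA hadj hu hw
    refine ⟨⟨⟨u, x.snd⟩, supported_mono _ hLY hu, hx.2⟩, ⟨hu, hx.2⟩,
      ⟨⟨w, 0⟩, supported_mono _ Set.sdiff_subset hw, Z.zero_mem⟩, ⟨hw, Z.zero_mem⟩, ?_⟩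
    refine Subtype.ext (BaerGroup.ext e.symm ?_)
    simp [snd_mul, hcross]

theorem strictKappaSet_graphGroup (h2 : (2 : ZMod p) ≠ 0)
    (b : Module.Basis (Fin m) (ZMod p) (graphSpace (ZMod p) G)) :
    strictKappaSet p n (graphGroup p G b) = vertexSeparatorSizes G :=
  Set.Subset.antisymm (fun _ => mem_vertexSeparatorSizes_of_mem_strictKappaSet h2 b)
    (fun _ => mem_strictKappaSet_of_mem_vertexSeparatorSizes h2 b)

/-- There is a regular subgroup of order `p` with `|S/[S,S]| = p^k` exactly for `k = 1`. -/
theorem exists_isRegular_card_eq_prime_iff (h2 : (2 : ZMod p) ≠ 0)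
    (b : Module.Basis (Fin m) (ZMod p) (graphSpace (ZMod p) G)) (i : Fin n) (k : ℕ) :
    (∃ S : Subgroup (graphGroup p G b), IsRegular S ∧ Nat.card (S ⧸ commutator S) = p ^ k ∧
      Nat.card S = p) ↔ k = 1 := by
  have hp := (Fact.out : p.Prime)
  constructor
  · rintro ⟨S, -, hcard, hS⟩
    have : IsCyclic S := isCyclic_of_prime_card hS
    have hbot : commutator S = ⊥ := by
      rw [_root_.commutator_def, Subgroup.commutator_eq_bot_iff_le_centralizer]
      exact fun x _ => Subgroup.mem_centralizer_iff.2 fun y _ => IsMulCommutative.is_comm.comm y x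
    rw [hbot, Nat.card_congr QuotientGroup.quotientBot.toEquiv, hS] at hcard
    exact (Nat.pow_right_injective hp.two_le ((pow_one p).trans hcard)).symm
  · rintro rfl
    -- A coordinate line is isotropic, so it is itself a subgroup, of order `p` and meeting `[P,P]`
    -- trivially.
    have hzero : ∀ u ∈ supported (ZMod p) {i}, ∀ v ∈ supported (ZMod p) {i},
        graphForm b u v ∈ (⊥ : Submodule (ZMod p) (Fin m → ZMod p)) := fun u hu v hv =>
      (graphForm_eq_zero_iff b).2 fun A hA =>
        dotProduct_mulVec_eq_zero_of_not_adj hA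
          (by rintro _ rfl _ rfl; exact SimpleGraph.irrefl _) hu hv
    let S : Subgroup (graphGroup p G b) := box (supported (ZMod p) {i}) ⊥ hzero
    have hone : S ⊓ commutator (graphGroup p G b) ≤ ⊥ := by
      intro g hg
      obtain ⟨hgS, hgc⟩ := Subgroup.mem_inf.1 hg
      exact BaerGroup.ext
        ((mem_commutator_iff h2 (graphForm_self b) (span_graphForm b)).1 hgc) hgS.2
    have hreg : IsRegular S := isRegular_of_le (hone.trans bot_le)
    have hbot : commutator S = ⊥ := by
      apply Subgroup.map_injective S.subtype_injective
      rw [Subgroup.map_subtype_commutator, hreg, Subgroup.map_bot]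
      exact le_bot_iff.1 hone
    have hcard := natCard_quotient_commutator h2 (graphForm_self b) (span_graphForm b) hreg
    rw [fstImage_box, finrank_supported, Set.ncard_singleton] at hcard
    refine ⟨S, hreg, hcard, ?_⟩
    rwa [hbot, Nat.card_congr QuotientGroup.quotientBot.toEquiv, pow_one] at hcard

theorem kappaSet_graphGroup (h2 : (2 : ZMod p) ≠ 0)
    (b : Module.Basis (Fin m) (ZMod p) (graphSpace (ZMod p) G)) (i : Fin n) :
    kappaSet p n (graphGroup p G b) = vertexCutSizes G := by
  have hleft : kappaSet p n (graphGroup p G b) =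
      strictKappaSet p n (graphGroup p G b) ∪ {s | n = s + 1} := by
    ext s
    have h := exists_isRegular_card_eq_prime_iff h2 b i (n - s)
    constructor
    · rintro ⟨hs, S, hS, hcard, hdec | hp⟩
      · exact Or.inl ⟨hs, S, hS, hcard, hdec⟩
      · have := h.1 ⟨S, hS, hcard, hp⟩
        exact Or.inr (show n = s + 1 by omega)
    · rintro (⟨hs, S, hS, hcard, hdec⟩ | hs)
      · exact ⟨hs, S, hS, hcard, Or.inl hdec⟩
      · have hs' : n = s + 1 := hs
        obtain ⟨S, hS, hcard, hp⟩ := h.2 (by omega)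
        exact ⟨by omega, S, hS, hcard, Or.inr hp⟩
  have hright : vertexCutSizes G = vertexSeparatorSizes G ∪ {s | n = s + 1} := by
    ext s
    constructor
    · rintro ⟨X, rfl, h | h⟩
      · exact Or.inl ⟨X, rfl, h⟩
      · exact Or.inr h
    · rintro (⟨X, rfl, h⟩ | h)
      · exact ⟨X, rfl, Or.inl h⟩
      · have h' : n = s + 1 := h
        obtain ⟨X, -, hX⟩ := Finset.exists_subset_card_eq (s := (Finset.univ : Finset (Fin n)))
          (n := s) (by simp; omega)
        exact ⟨X, hX, Or.inr (by omega)⟩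
  rw [hleft, hright, strictKappaSet_graphGroup h2 b]

theorem edgeCutSizes_subset_lambdaSet (h2 : (2 : ZMod p) ≠ 0)
    (b : Module.Basis (Fin m) (ZMod p) (graphSpace (ZMod p) G)) :
    edgeCutSizes G ⊆ lambdaSet p (graphGroup p G b) := by
  rintro _ ⟨D, hDG, rfl, hD⟩
  obtain ⟨L, ⟨i, hi⟩, ⟨j, hj⟩, hadj⟩ := (not_preconnected_iff _).1 hD
  set H := G.deleteEdges (D : Set (Sym2 (Fin n)))
  have hHG : H ≤ G := G.deleteEdges_le _
  -- Only the matrices of the remaining graph `H` survive modulo its annihilator, whose dimension is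
  -- `m` minus the number of edges of `H`, that is `D.card`.
  let N : Subgroup (graphGroup p G b) := box ⊥ (annihilator b H) (fun u hu v _ => by
    rw [(Submodule.mem_bot _).1 hu, map_zero]
    exact Submodule.zero_mem _)
  have hNfst : ∀ g ∈ N, g.fst = 0 := fun g hg => hg.1
  have hNc : N ≤ Subgroup.center (graphGroup p G b) := fun g hg =>
    commutator_le_center h2 (graphForm_self b) (span_graphForm b)
      ((mem_commutator_iff h2 (graphForm_self b) (span_graphForm b)).2 (hNfst g hg))
  have hNn : N.Normal := ⟨fun g hg h => by
    rwa [Subgroup.mem_center_iff.1 (hNc hg) h, mul_inv_cancel_right]⟩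
  have hNsnd : sndFiber N = annihilator b H := by
    ext z
    exact ⟨fun h => (mem_sndFiber.1 h).2, fun h => mem_sndFiber.2 ⟨Submodule.zero_mem _, h⟩⟩
  have hbox : ∀ (T : Set (Fin n)) (k l : Fin n), k ∈ T → l ∉ T →
      (box (φ := graphForm b) (supported (ZMod p) T) ⊤ (fun _ _ _ _ => trivial)).map
        (QuotientGroup.mk' N) ≠ ⊥ ∧
      (box (φ := graphForm b) (supported (ZMod p) T) ⊤ (fun _ _ _ _ => trivial)).map
        (QuotientGroup.mk' N) ≠ ⊤ := by
    intro T k l hk hl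
    constructor
    · intro e
      have hk' := Subgroup.mem_map_of_mem (QuotientGroup.mk' N)
        (show (⟨Pi.single k 1, 0⟩ : graphGroup p G b) ∈
          box (supported (ZMod p) T) ⊤ (fun _ _ _ _ => trivial) from
          ⟨single_mem_supported.2 hk, trivial⟩)
      rw [e, Subgroup.mem_bot] at hk'
      have := congrFun (hNfst _ ((QuotientGroup.eq_one_iff _).1 hk')) k
      simp at this
    · intro e
      obtain ⟨x, hx, hxl⟩ : QuotientGroup.mk' N (⟨Pi.single l 1, 0⟩ : graphGroup p G b) ∈
          (box (φ := graphForm b) (supported (ZMod p) T) ⊤ (fun _ _ _ _ => trivial)).map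
            (QuotientGroup.mk' N) := by
        rw [e]; trivial
      have := hNfst _ (QuotientGroup.eq.1 hxl)
      rw [fst_mul, fst_inv, neg_add_eq_zero] at this
      exact hl (single_mem_supported.1 (this ▸ hx.1))
  refine ⟨N, hNn, hNc, ?_, _, _, (hbox L i j hi hj).1, (hbox L i j hi hj).2,
    (hbox Lᶜ j i hj (by simpa using hi)).1, (hbox Lᶜ j i hj (by simpa using hi)).2, ?_, ?_⟩
  · rw [natCard_eq_of_fst_eq_zero hNfst, hNsnd]
    congr 1
    have h1 := finrank_annihilator b hHG
    have h2 : G.edgeSet.ncard = m := by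
      rw [← finrank_graphSpace (ZMod p), Module.finrank_eq_card_basis b, Fintype.card_fin]
    have h3 : H.edgeSet.ncard + (D : Set (Sym2 (Fin n))).ncard = G.edgeSet.ncard := by
      rw [SimpleGraph.edgeSet_deleteEdges]
      exact Set.ncard_sdiff_add_ncard_of_subset hDG
    rw [Set.ncard_coe_finset] at h3
    omega
  · rintro _ ⟨x, hx, rfl⟩ _ ⟨y, hy, rfl⟩
    rw [← commutatorElement_eq_one_iff_mul_comm, ← map_commutatorElement,
      commutatorElement_eq h2 (graphForm_self b)]
    refine (QuotientGroup.eq_one_iff _).2 ⟨Submodule.zero_mem _, ?_⟩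
    exact (graphForm_mem_annihilator_iff b hHG).2 fun A hA =>
      dotProduct_mulVec_eq_zero_of_not_adj hA hadj hx.1 hy.1
  · intro x
    obtain ⟨x, rfl⟩ := QuotientGroup.mk'_surjective N x
    obtain ⟨u, hu, w, hw, e⟩ := exists_add_of_mem_supported (Y := Set.univ) (v := x.fst) L
      (mem_supported.2 fun i hi => absurd trivial hi)
    -- Here `φ(u, w)` vanishes only modulo `N`; subtracting half of it makes the product equal to
    -- `x` already in `P`.
    refine ⟨_, ⟨⟨u, x.snd - (2 : ZMod p)⁻¹ • graphForm b u w⟩, ⟨hu, trivial⟩, rfl⟩,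
      _, ⟨⟨w, 0⟩, ⟨by rwa [Set.compl_eq_univ_sdiff], trivial⟩, rfl⟩, ?_⟩
    rw [← map_mul]
    congr 1
    refine BaerGroup.ext e.symm ?_
    simp [snd_mul]

theorem fst_eq_zero_of_mem_center (h2 : (2 : ZMod p) ≠ 0)
    (b : Module.Basis (Fin m) (ZMod p) (graphSpace (ZMod p) G))
    (hG : ∀ i, ∃ j, G.Adj i j) {g : graphGroup p G b}
    (hg : g ∈ Subgroup.center (graphGroup p G b)) : g.fst = 0 := by
  ext i
  obtain ⟨j, hij⟩ := hG i
  have h := (Subgroup.mem_center_iff.1 hg ⟨Pi.single j 1, 0⟩).symm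
  rw [mul_comm_iff h2 (graphForm_self b), graphForm_eq_zero_iff] at h
  have := h _ (elemAlt_mem_graphSpace hij)
  rw [dotProduct_elemAlt_mulVec] at this
  simpa [Pi.single_apply, hij.ne] using this

theorem exists_edgeCut_le_of_mem_lambdaSet (h2 : (2 : ZMod p) ≠ 0)
    (b : Module.Basis (Fin m) (ZMod p) (graphSpace (ZMod p) G)) (hn : 2 ≤ n) {s : ℕ}
    (hs : s ∈ lambdaSet p (graphGroup p G b)) : ∃ t ∈ edgeCutSizes G, t ≤ s := by
  -- Without isolated vertices the centre lies in the second summand, so `N` does too. An isolated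
  -- vertex enlarges the centre, but then the empty set is an edge cut.
  by_cases hG : ∀ i, ∃ j, G.Adj i j
  · obtain ⟨N, hNn, hNc, hcard, hdec⟩ := hs
    have hN : ∀ g ∈ N, g.fst = 0 := fun g hg => fst_eq_zero_of_mem_center h2 b hG (hNc hg)
    rw [natCard_eq_of_fst_eq_zero hN] at hcard
    have hfin := Nat.pow_right_injective (Fact.out : p.Prime).two_le hcard
    obtain ⟨U, W, hUW, hU, hW, horth⟩ := exists_orthogonal_of_centrallyDecomposable_quotient h2
      (graphForm_self b) (span_graphForm b) hN hdec
    obtain ⟨L, hL, hL', hsep⟩ := exists_crossing_separating G hn hUW hU hW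
    exact ⟨_, ncard_crossing_mem_edgeCutSizes G hL hL',
      (ncard_edgeSet_le_finrank b (crossing_le G L) horth hsep).trans hfin.le⟩
  · push Not at hG
    obtain ⟨i, hi⟩ := hG
    have : Nontrivial (Fin n) := Fin.nontrivial_iff_two_le.2 hn
    obtain ⟨j, hj⟩ := exists_ne i
    refine ⟨0, ⟨∅, by simp, rfl, (not_preconnected_iff _).2
      ⟨{i}, Set.singleton_nonempty i, ⟨j, hj⟩, ?_⟩⟩, Nat.zero_le s⟩
    rintro _ rfl k - h
    rw [SimpleGraph.deleteEdges_adj] at h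
    exact hi k h.1

theorem exists_isLeast {S : Set ℕ} (h : S.Nonempty) : ∃ l, IsLeast S l := by
  classical
  exact ⟨Nat.find h, Nat.find_spec h, fun _ hs => Nat.find_min' h hs⟩

end GraphGroup

end BLT

theorem theorem1 (p : ℕ) [Fact p.Prime] (hp : p ≠ 2) (n m : ℕ) (G : SimpleGraph (Fin n))
    (hm : G.edgeSet.ncard = m) (hm0 : 0 < m) :
    Module.finrank (ZMod p) (BLT.graphSpace (ZMod p) G) = m ∧
    ∀ b : Module.Basis (Fin m) (ZMod p) (BLT.graphSpace (ZMod p) G),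
      BLT.IsB p n m (BLT.graphGroup p G b) ∧
      (∃ κ : ℕ, IsLeast (BLT.vertexCutSizes G) κ ∧
        IsLeast (BLT.kappaSet p n (BLT.graphGroup p G b)) κ) ∧
      (∀ κ : ℕ, IsLeast (BLT.vertexSeparatorSizes G) κ ↔
        IsLeast (BLT.strictKappaSet p n (BLT.graphGroup p G b)) κ) ∧
      (∃ l : ℕ, IsLeast (BLT.edgeCutSizes G) l ∧
        IsLeast (BLT.lambdaSet p (BLT.graphGroup p G b)) l) := by
  have h2 := BLT.BaerGroup.two_ne_zero_of_ne_two hp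
  refine ⟨(BLT.finrank_graphSpace _ G).trans hm, fun b => ?_⟩
  obtain ⟨i, j, hij⟩ : ∃ i j, G.Adj i j := by
    obtain ⟨e, he⟩ := Set.nonempty_of_ncard_ne_zero (hm.trans_ne hm0.ne')
    induction e using Sym2.ind with
    | _ i j => exact ⟨i, j, he⟩
  have hn : 2 ≤ n := Fin.nontrivial_iff_two_le.1 ⟨i, j, hij.ne⟩
  refine ⟨BLT.isB_graphGroup h2 b hij, ?_, ?_, ?_⟩
  · rw [BLT.kappaSet_graphGroup h2 b i]
    obtain ⟨κ, hκ⟩ := BLT.exists_isLeast (S := BLT.vertexCutSizes G)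
      ⟨_, {i}ᶜ, rfl, Or.inr (by rw [Finset.card_compl]; simp; omega)⟩
    exact ⟨κ, hκ, hκ⟩
  · intro κ
    rw [BLT.strictKappaSet_graphGroup h2 b]
  · obtain ⟨l, hl⟩ := BLT.exists_isLeast (S := BLT.edgeCutSizes G)
      ⟨_, BLT.ncard_crossing_mem_edgeCutSizes G (Set.singleton_nonempty i) ⟨j, hij.ne'⟩⟩
    -- For `λ` one inclusion, together with an edge cut below every element of `lambdaSet`, is
    -- enough to compare minima.
    refine ⟨l, hl, BLT.edgeCutSizes_subset_lambdaSet h2 b hl.1, fun s hs => ?_⟩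
    obtain ⟨t, ht, hts⟩ := BLT.exists_edgeCut_le_of_mem_lambdaSet h2 b hn hs
    exact (hl.2 ht).trans hts
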